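/- Let $\mathbb F\in\{\mathbb R,\mathbb C\}$. A real-time quantum finite automaton over a finite input alphabet $\Sigma$ has a finite state set $Q$, an initial state $q_1\in Q$ and, for each symbol $\sigma\in\Sigma\cup\{\vdash,\dashv\}$ ($\vdash,\dashv$ are end-markers), finitely many matrices $E_{\sigma,1},\dots,E_{\sigma,k}\in\mathbb F^{Q\times Q}$ with $\sum_i E_{\sigma,i}^\dagger E_{\sigma,i}=I$. On input $w\in\Sigma^*$ it starts in $\rho=|q_1\rangle\langle q_1|$, reads $\vdash w\dashv$ from left to right, replacing $\rho$ by $\sum_i E_{\sigma,i}\,\rho\, E_{\sigma,i}^\dagger$ on reading $\sigma$, and then the type of the state is measured once. In the standard model each state is an accepting or a rejecting one; $\mathsf{NQAL}$ is the class of languages $L$ for which some such automaton accepts $w$ with nonzero probability if and only if $w\in L$. In the model with postselection (QFAP) the states are partitioned into $Q_{pa},Q_{pr},Q_{nh}$; with $p^a(w),p^r(w)$ the probabilities of observing $Q_{pa},Q_{pr}$ at the end, it is required that $p^a(w)+p^r(w)>0$ for all $w$, and $w$ is accepted with probability $\frac{p^a(w)}{p^a(w)+p^r(w)}$ and rejected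 with probability $\frac{p^r(w)}{p^a(w)+p^r(w)}$. A PFAP is the classical counterpart: column-stochastic real matrices $A_\sigma$ act on the state vector, which starts at $q_1$, the input is read as $\vdash w\dashv$, and the postselection requirement and the normalization are the same. A machine recognizes $L$ with bounded error if for some $\varepsilon\in[0,\frac12)$ it accepts every $w\in L$ and rejects every $w\in\Sigma^*\setminus L$ with probability at least $1-\varepsilon$; it does so with one-sided bounded error if moreover it accepts $w$ with nonzero probability if and only if $w\in L$. Let $\mathsf{PostBQAL}$ (resp. $\mathsf{PostBS}$) be the class of languages recognized with bounded error by QFAPs (resp. PFAPs), and $\mathsf{PostRQAL}$ the class of languages recognized with one-sided bounded error by QFAPs. Theorem. $\mathsf{PostRQAL}\subsetneq\mathsf{PostBQAL}$. That is, over every finite alphabet each language in $\mathsf{PostRQAL}$ is in $\mathsf{PostBQAL}$, and over the alphabet $\{a,b\}$ the inclusion is proper. A witness is the language $$L_{eq\overline{eq}}=\{a w_1 : w_1\in L_{eq}\}\cup\{b w_2 : w_2\in\{a,b\}^*\setminus L_{eq}\},\qquad L_{eq}=\{w\in\{a,b\}^* : |w|_a=|w|_b\},$$ where $|w|_\sigma$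 is the number of occurrences of $\sigma$ in $w$: it belongs to $\mathsf{PostBS}$ and to $\mathsf{PostBQAL}$, but neither to $\mathsf{NQAL}$ nor to $\mathsf{PostRQAL}$. -/

import Mathlib

/-- The tape alphabet `Σ ∪ {⊢, ⊣}` over an input alphabet `α`. -/
inductive TapeSymbol (α : Type*) where
  | leftEnd : TapeSymbol α
  | letter : α → TapeSymbol α
  | rightEnd : TapeSymbol α

/-- The string `⊢ w ⊣` that is read by a real-time machine on input `w`. -/
def tapeWord {α : Type*} (w : List α) : List (TapeSymbol α) :=
  TapeSymbol.leftEnd :: (w.map TapeSymbol.letter ++ [TapeSymbol.rightEnd])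

/-- The final outcomes of a machine with postselection: postselection accept,
postselection reject, nonpostselection halting. -/
inductive PostOutcome where
  | pa : PostOutcome
  | pr : PostOutcome
  | nh : PostOutcome
  deriving DecidableEq

/-- The final outcomes of a standard real-time machine: accept, reject. -/
inductive StdOutcome where
  | acc : StdOutcome
  | rej : StdOutcome
  deriving DecidableEq

/-! ### Probabilistic automata -/

/-- The transition part of a real-time probabilistic finite automaton with state set `Q`:
`A σ j i` is the probability of going from state `i` to state `j` when reading `σ`, so that
the columns of each `A σ` are stochastic vectors. -/
structure ProbAutomaton (α : Type*) (Q : Type*) [Fintype Q] [DecidableEq Q] where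
  init : Q
  A : TapeSymbol α → Matrix Q Q ℝ
  A_nonneg : ∀ σ j i, 0 ≤ A σ j i
  A_sum : ∀ σ i, ∑ j, A σ j i = 1

namespace ProbAutomaton

variable {α : Type*} {Q : Type*} [Fintype Q] [DecidableEq Q]

/-- The state vector after the whole string `⊢ w ⊣` has been read. -/
def finalVec (M : ProbAutomaton α Q) (w : List α) : Q → ℝ :=
  (tapeWord w).foldl (fun v σ => (M.A σ).mulVec v) (Pi.single M.init 1)

/-- The probability of ending in a state of type `τ`, where `f` gives the type of each state. -/
def outcomeProb {Δ : Type*} [DecidableEq Δ] (M : ProbAutomaton α Q) (f : Q → Δ) (τ : Δ)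
    (w : List α) : ℝ :=
  ∑ q with f q = τ, M.finalVec w q

end ProbAutomaton

/-- A real-time probabilistic finite automaton with postselection. -/
structure PFAP (α : Type*) (Q : Type*) [Fintype Q] [DecidableEq Q]
    extends ProbAutomaton α Q where
  outcome : Q → PostOutcome
  postselects : ∀ w : List α,
    0 < toProbAutomaton.outcomeProb outcome PostOutcome.pa w +
      toProbAutomaton.outcomeProb outcome PostOutcome.pr w

namespace PFAP

variable {α : Type*} {Q : Type*} [Fintype Q] [DecidableEq Q]

/-- Acceptance probability before postselection. -/
def preAcc (M : PFAP α Q) (w : List α) : ℝ :=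
  M.outcomeProb M.outcome PostOutcome.pa w

/-- Rejection probability before postselection. -/
def preRej (M : PFAP α Q) (w : List α) : ℝ :=
  M.outcomeProb M.outcome PostOutcome.pr w

/-- The probability that `M` accepts `w`. -/
noncomputable def acceptProb (M : PFAP α Q) (w : List α) : ℝ :=
  M.preAcc w / (M.preAcc w + M.preRej w)

/-- The probability that `M` rejects `w`. -/
noncomputable def rejectProb (M : PFAP α Q) (w : List α) : ℝ :=
  M.preRej w / (M.preAcc w + M.preRej w)

end PFAP

/-! ### Quantum automata -/

/-- The transition part of a real-time quantum finite automaton with state set `Q` and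
amplitudes in `𝕜` (the reals or the complex numbers): each symbol `σ` acts by the
superoperator with operation elements `E σ 0, …, E σ (k σ - 1)`. -/
structure QuantumAutomaton (𝕜 : Type*) [RCLike 𝕜] (α : Type*) (Q : Type*)
    [Fintype Q] [DecidableEq Q] where
  init : Q
  k : TapeSymbol α → ℕ
  E : (σ : TapeSymbol α) → Fin (k σ) → Matrix Q Q 𝕜
  E_complete : ∀ σ, ∑ i, (E σ i).conjTranspose * E σ i = 1

namespace QuantumAutomaton

variable {𝕜 : Type*} [RCLike 𝕜] {α : Type*} {Q : Type*} [Fintype Q] [DecidableEq Q]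

/-- The superoperator applied when reading `σ`. -/
def step (M : QuantumAutomaton 𝕜 α Q) (ρ : Matrix Q Q 𝕜) (σ : TapeSymbol α) :
    Matrix Q Q 𝕜 :=
  ∑ i, M.E σ i * ρ * (M.E σ i).conjTranspose

/-- The density matrix after the whole string `⊢ w ⊣` has been read, starting from the pure
initial state. -/
def finalDensity (M : QuantumAutomaton 𝕜 α Q) (w : List α) : Matrix Q Q 𝕜 :=
  (tapeWord w).foldl M.step (Matrix.single M.init M.init 1)

/-- The projector on the span of the states of type `τ`. -/
def projector {Δ : Type*} [DecidableEq Δ] (f : Q → Δ) (τ : Δ) : Matrix Q Q 𝕜 :=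
  Matrix.diagonal (fun q => if f q = τ then 1 else 0)

/-- The probability of observing a state of type `τ` in the measurement at the end. The trace
is a real number; `RCLike.re` only changes its type. -/
def outcomeProb {Δ : Type*} [DecidableEq Δ] (M : QuantumAutomaton 𝕜 α Q) (f : Q → Δ) (τ : Δ)
    (w : List α) : ℝ :=
  RCLike.re (projector f τ * M.finalDensity w).trace

end QuantumAutomaton

/-- A real-time quantum finite automaton (without postselection). -/
structure RTQFA (𝕜 : Type*) [RCLike 𝕜] (α : Type*) (Q : Type*) [Fintype Q] [DecidableEq Q]
    extends QuantumAutomaton 𝕜 α Q where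
  outcome : Q → StdOutcome

/-- The probability that the real-time quantum finite automaton `M` accepts `w`. -/
def RTQFA.acceptProb {𝕜 : Type*} [RCLike 𝕜] {α : Type*} {Q : Type*} [Fintype Q]
    [DecidableEq Q] (M : RTQFA 𝕜 α Q) (w : List α) : ℝ :=
  M.outcomeProb M.outcome StdOutcome.acc w

/-- A real-time quantum finite automaton with postselection. -/
structure QFAP (𝕜 : Type*) [RCLike 𝕜] (α : Type*) (Q : Type*) [Fintype Q] [DecidableEq Q]
    extends QuantumAutomaton 𝕜 α Q where
  outcome : Q → PostOutcome
  postselects : ∀ w : List α,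
    0 < toQuantumAutomaton.outcomeProb outcome PostOutcome.pa w +
      toQuantumAutomaton.outcomeProb outcome PostOutcome.pr w

namespace QFAP

variable {𝕜 : Type*} [RCLike 𝕜] {α : Type*} {Q : Type*} [Fintype Q] [DecidableEq Q]

/-- Acceptance probability before postselection. -/
def preAcc (M : QFAP 𝕜 α Q) (w : List α) : ℝ :=
  M.outcomeProb M.outcome PostOutcome.pa w

/-- Rejection probability before postselection. -/
def preRej (M : QFAP 𝕜 α Q) (w : List α) : ℝ :=
  M.outcomeProb M.outcome PostOutcome.pr w

/-- The probability that `M` accepts `w`. -/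
noncomputable def acceptProb (M : QFAP 𝕜 α Q) (w : List α) : ℝ :=
  M.preAcc w / (M.preAcc w + M.preRej w)

/-- The probability that `M` rejects `w`. -/
noncomputable def rejectProb (M : QFAP 𝕜 α Q) (w : List α) : ℝ :=
  M.preRej w / (M.preAcc w + M.preRej w)

end QFAP

/-! ### Error regimes and language classes -/

/-- Recognition of `L` with cutpoint zero, by a machine with the given acceptance
probabilities. -/
def NondetRecognizes {α : Type*} (acc : List α → ℝ) (L : Language α) : Prop :=
  ∀ w, w ∈ L ↔ 0 < acc w

/-- Recognition of `L` with two-sided bounded error, by a machine with the given acceptance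
and rejection probabilities. -/
def BoundedErrorRecognizes {α : Type*} (acc rej : List α → ℝ) (L : Language α) : Prop :=
  ∃ ε : ℝ, 0 ≤ ε ∧ ε < 1 / 2 ∧ (∀ w ∈ L, 1 - ε ≤ acc w) ∧ (∀ w ∉ L, 1 - ε ≤ rej w)

/-- Recognition of `L` with one-sided bounded error: by a nondeterministic machine with
bounded error. -/
def OneSidedErrorRecognizes {α : Type*} (acc rej : List α → ℝ) (L : Language α) : Prop :=
  NondetRecognizes acc L ∧ BoundedErrorRecognizes acc rej L

/-- Languages over `α` recognized with two-sided bounded error by PFAPs. -/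
def PostBS (α : Type*) : Set (Language α) :=
  {L | ∃ (Q : Type) (_ : Fintype Q) (_ : DecidableEq Q) (M : PFAP α Q),
    BoundedErrorRecognizes M.acceptProb M.rejectProb L}

/-- Languages over `α` recognized with two-sided bounded error by QFAPs. -/
def PostBQAL (𝕜 : Type*) [RCLike 𝕜] (α : Type*) : Set (Language α) :=
  {L | ∃ (Q : Type) (_ : Fintype Q) (_ : DecidableEq Q) (M : QFAP 𝕜 α Q),
    BoundedErrorRecognizes M.acceptProb M.rejectProb L}

/-- Languages over `α` recognized with one-sided bounded error by QFAPs. -/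
def PostRQAL (𝕜 : Type*) [RCLike 𝕜] (α : Type*) : Set (Language α) :=
  {L | ∃ (Q : Type) (_ : Fintype Q) (_ : DecidableEq Q) (M : QFAP 𝕜 α Q),
    OneSidedErrorRecognizes M.acceptProb M.rejectProb L}

/-- Languages over `α` recognized with cutpoint zero by real-time quantum finite automata. -/
def NQAL (𝕜 : Type*) [RCLike 𝕜] (α : Type*) : Set (Language α) :=
  {L | ∃ (Q : Type) (_ : Fintype Q) (_ : DecidableEq Q) (M : RTQFA 𝕜 α Q),
    NondetRecognizes M.acceptProb L}

/-! ### The witness language -/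

/-- The alphabet `{a, b}`. -/
inductive AB where
  | a : AB
  | b : AB
  deriving DecidableEq

instance : Fintype AB := ⟨{AB.a, AB.b}, fun x => by cases x <;> simp⟩

/-- Strings over `{a, b}` with as many `a`s as `b`s. -/
def Leq : Language AB :=
  {w : List AB | w.count AB.a = w.count AB.b}

/-- The language `a Leq ∪ b (complement of Leq)`. -/
def LeqCoeq : Language AB :=
  {w : List AB | (∃ w₁, w₁ ∈ Leq ∧ w = AB.a :: w₁) ∨ (∃ w₂, w₂ ∉ Leq ∧ w = AB.b :: w₂)}

/-! Acceptance with nonzero probability is insensitive to the postselection normalization, so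
one-sided error places a language in `NQAL`. The witness is not there: up to its end-markers, the
acceptance probability of `a a^i b^j` is a linear functional depending on `j` applied to a density
matrix depending on `i`, all in one finite-dimensional real space, while cutpoint zero would make
these numbers nonzero exactly for `i = j`. An infinite diagonal matrix with nonzero diagonal has no
finite rank (`not_outcomeProb_append_diagonal`).

For two-sided error a PFAP suffices, since quantum automata simulate probabilistic ones
(`toQuantum`). With `x = 8^(-|w|_a)` and `y = 8^(-|w|_b)`, the PFAP compares `2/3 * (x * y)` with
`1/6 * (x^2 + y^2)`. If `x = y` the first is twice the second; otherwise `8 * (x * y) ≤ x^2 + y^2`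
(`eight_mul_le`), and the second is at least twice the first. The first letter decides which of the
two means acceptance. -/

open scoped ComplexOrder

/-! ### Density matrices of quantum automata -/

namespace QuantumAutomaton

variable {𝕜 : Type*} [RCLike 𝕜] {α : Type*} {Q : Type*} [Fintype Q] [DecidableEq Q]

/-- The superoperator of a symbol as a linear map over the reals. -/
noncomputable def stepLinear (M : QuantumAutomaton 𝕜 α Q) (σ : TapeSymbol α) :
    Matrix Q Q 𝕜 →ₗ[ℝ] Matrix Q Q 𝕜 where
  toFun ρ := M.step ρ σ
  map_add' ρ τ := by simp [step, mul_add, add_mul, Finset.sum_add_distrib]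
  map_smul' c ρ := by simp [step, Finset.smul_sum]

/-- The superoperator of a string of symbols as a linear map over the reals. -/
noncomputable def runLinear (M : QuantumAutomaton 𝕜 α Q) :
    List (TapeSymbol α) → Matrix Q Q 𝕜 →ₗ[ℝ] Matrix Q Q 𝕜
  | [] => LinearMap.id
  | σ :: l => M.runLinear l ∘ₗ M.stepLinear σ

theorem runLinear_apply (M : QuantumAutomaton 𝕜 α Q) (l : List (TapeSymbol α))
    (ρ : Matrix Q Q 𝕜) : M.runLinear l ρ = l.foldl M.step ρ := by
  induction l generalizing ρ with
  | nil => rfl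
  | cons σ l ih => exact ih _

/-- The probability of the outcome `τ` as a real linear functional of the density matrix. -/
noncomputable def outcomeLinear {Δ : Type*} [DecidableEq Δ] (f : Q → Δ) (τ : Δ) : Matrix Q Q 𝕜 →ₗ[ℝ] ℝ where
  toFun ρ := RCLike.re (projector f τ * ρ).trace
  map_add' ρ τ := by simp [mul_add]
  map_smul' c ρ := by simp [RCLike.smul_re]

theorem outcomeProb_eq_sum {Δ : Type*} [DecidableEq Δ] (M : QuantumAutomaton 𝕜 α Q)
    (f : Q → Δ) (τ : Δ) (w : List α) :
    M.outcomeProb f τ w = ∑ q with f q = τ, RCLike.re (M.finalDensity w q q) := by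
  simp only [outcomeProb, projector, Matrix.trace, Matrix.diag_apply, Matrix.diagonal_mul,
    map_sum, Finset.sum_filter]
  refine Finset.sum_congr rfl fun q _ => ?_
  split_ifs <;> simp

theorem posSemidef_step (M : QuantumAutomaton 𝕜 α Q) {ρ : Matrix Q Q 𝕜} (hρ : ρ.PosSemidef)
    (σ : TapeSymbol α) : (M.step ρ σ).PosSemidef :=
  Matrix.posSemidef_sum _ fun _ _ => hρ.mul_mul_conjTranspose_same _

theorem posSemidef_foldl (M : QuantumAutomaton 𝕜 α Q) {ρ : Matrix Q Q 𝕜} (hρ : ρ.PosSemidef)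
    (l : List (TapeSymbol α)) : (l.foldl M.step ρ).PosSemidef := by
  induction l generalizing ρ with
  | nil => exact hρ
  | cons σ l ih => exact ih (M.posSemidef_step hρ σ)

theorem posSemidef_finalDensity (M : QuantumAutomaton 𝕜 α Q) (w : List α) :
    (M.finalDensity w).PosSemidef := by
  refine M.posSemidef_foldl ?_ _
  rw [← Matrix.diagonal_single]
  refine Matrix.PosSemidef.diagonal fun q => ?_
  by_cases h : q = M.init
  · subst h; simp
  · simp [h]

theorem outcomeProb_nonneg {Δ : Type*} [DecidableEq Δ] (M : QuantumAutomaton 𝕜 α Q)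
    (f : Q → Δ) (τ : Δ) (w : List α) : 0 ≤ M.outcomeProb f τ w := by
  rw [outcomeProb_eq_sum]
  exact Finset.sum_nonneg fun q _ =>
    (RCLike.nonneg_iff.1 ((M.posSemidef_finalDensity w).diag_nonneg (i := q))).1

/-- The matrix of outcome probabilities of the strings `u i ++ v j` cannot be an infinite
diagonal matrix with nonzero diagonal. -/
theorem not_outcomeProb_append_diagonal {Δ : Type*} [DecidableEq Δ]
    (M : QuantumAutomaton 𝕜 α Q) (f : Q → Δ) (τ : Δ) (u v : ℕ → List α)
    (hdiag : ∀ i, M.outcomeProb f τ (u i ++ v i) ≠ 0)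
    (hoff : ∀ i j, i ≠ j → M.outcomeProb f τ (u i ++ v j) = 0) : False := by
  let d : ℕ → Matrix Q Q 𝕜 := fun i =>
    (TapeSymbol.leftEnd :: (u i).map TapeSymbol.letter).foldl M.step (Matrix.single M.init M.init 1)
  let φ : ℕ → Matrix Q Q 𝕜 →ₗ[ℝ] ℝ := fun j =>
    outcomeLinear f τ ∘ₗ M.runLinear ((v j).map TapeSymbol.letter ++ [TapeSymbol.rightEnd])
  have hφ : ∀ i j, φ j (d i) = M.outcomeProb f τ (u i ++ v j) := by
    intro i j
    simp only [φ, d, LinearMap.comp_apply, runLinear_apply, ← List.foldl_append]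
    simp [outcomeProb, finalDensity, tapeWord, outcomeLinear]
  -- Applying `φ j` to a vanishing combination of the `d i` leaves only the `j`-th term, whose value
  -- on `d j` is nonzero.
  have hind : LinearIndependent ℝ d := by
    rw [linearIndependent_iff']
    intro s c hc j hj
    have h := congrArg (φ j) hc
    simp only [map_sum, map_smul, hφ, map_zero, smul_eq_mul] at h
    rw [Finset.sum_eq_single_of_mem j hj fun i _ hij => by rw [hoff i j hij, mul_zero]] at h
    exact (mul_eq_zero.1 h).resolve_right (hdiag j)
  have : FiniteDimensional ℝ 𝕜 := inferInstance
  have : FiniteDimensional ℝ (Matrix Q Q 𝕜) := inferInstance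
  exact not_finite_iff_infinite.2 (inferInstance : Infinite ℕ) hind.finite

end QuantumAutomaton

/-! ### One-sided error and cutpoint zero -/

theorem QFAP.acceptProb_pos_iff {𝕜 : Type*} [RCLike 𝕜] {α : Type*} {Q : Type*} [Fintype Q]
    [DecidableEq Q] (M : QFAP 𝕜 α Q) (w : List α) : 0 < M.acceptProb w ↔ 0 < M.preAcc w :=
  div_pos_iff_of_pos_right (M.postselects w)

/-- The same automaton works without postselection when the nonpostselection states are also
declared rejecting: dividing by a positive normalization does not change which inputs have positive
acceptance probability. -/
theorem PostRQAL_subset_NQAL (𝕜 : Type*) [RCLike 𝕜] (α : Type*) :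
    PostRQAL 𝕜 α ⊆ NQAL 𝕜 α := by
  rintro L ⟨Q, _, _, M, hM, -⟩
  refine ⟨Q, _, _, ⟨M.toQuantumAutomaton,
    fun q => if M.outcome q = PostOutcome.pa then StdOutcome.acc else StdOutcome.rej⟩,
    fun w => ?_⟩
  rw [hM w, M.acceptProb_pos_iff, QFAP.preAcc, RTQFA.acceptProb,
    QuantumAutomaton.outcomeProb_eq_sum, QuantumAutomaton.outcomeProb_eq_sum]
  simp

theorem PostRQAL_subset_PostBQAL (𝕜 : Type*) [RCLike 𝕜] (α : Type*) :
    PostRQAL 𝕜 α ⊆ PostBQAL 𝕜 α := by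
  rintro L ⟨Q, _, _, M, -, hM⟩
  exact ⟨Q, _, _, M, hM⟩

theorem cons_a_mem_LeqCoeq {w : List AB} : AB.a :: w ∈ LeqCoeq ↔ w.count AB.a = w.count AB.b := by
  change (_ ∨ _) ↔ _
  simp [Leq]
  rfl

theorem cons_b_mem_LeqCoeq {w : List AB} : AB.b :: w ∈ LeqCoeq ↔ w.count AB.a ≠ w.count AB.b := by
  change (_ ∨ _) ↔ _
  simp [Leq]
  rfl

theorem nil_notMem_LeqCoeq : [] ∉ LeqCoeq := by
  rintro (⟨_, _, h⟩ | ⟨_, _, h⟩) <;> cases h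

/-- Only inputs beginning with `a` are needed: on these the language reduces to `Leq`, and prefixes
`a a^i` against suffixes `b^j` give the forbidden diagonal matrix. -/
theorem LeqCoeq_notMem_NQAL (𝕜 : Type*) [RCLike 𝕜] : LeqCoeq ∉ NQAL 𝕜 AB := by
  rintro ⟨Q, _, _, M, hM⟩
  have key : ∀ i j : ℕ, 0 < M.outcomeProb M.outcome StdOutcome.acc
      (AB.a :: List.replicate i AB.a ++ List.replicate j AB.b) ↔ i = j := by
    intro i j
    rw [← RTQFA.acceptProb, ← hM, List.cons_append, cons_a_mem_LeqCoeq]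
    simp [List.count_replicate]
  refine M.not_outcomeProb_append_diagonal M.outcome StdOutcome.acc
    (fun i => AB.a :: List.replicate i AB.a) (fun j => List.replicate j AB.b)
    (fun i => ((key i i).2 rfl).ne') fun i j hij => ?_
  -- Cutpoint zero only says that the probability is not positive; nonnegativity makes it vanish.
  exact le_antisymm (not_lt.1 fun h => hij ((key i j).1 h)) (M.outcomeProb_nonneg _ _ _)

/-! ### Quantum simulation of probabilistic automata -/

namespace ProbAutomaton

variable (𝕜 : Type*) [RCLike 𝕜] {α : Type*} {Q : Type*} [Fintype Q] [DecidableEq Q]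

/-- The operation element `√(A j i) |j⟩⟨i|` of the superoperator of a stochastic matrix. -/
noncomputable def operationElement (M : ProbAutomaton α Q) (σ : TapeSymbol α) (x : Q × Q) :
    Matrix Q Q 𝕜 :=
  Matrix.single x.1 x.2 ((√(M.A σ x.1 x.2) : ℝ) : 𝕜)

theorem sqrt_A_mul_self (M : ProbAutomaton α Q) (σ : TapeSymbol α) (j i : Q) :
    ((√(M.A σ j i) : ℝ) : 𝕜) * ((√(M.A σ j i) : ℝ) : 𝕜) = (M.A σ j i : 𝕜) := by
  rw [← RCLike.ofReal_mul, Real.mul_self_sqrt (M.A_nonneg σ j i)]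

/-- Each summand is `A j i |i⟩⟨i|`, so summing over `j` first gives the column sums, which are 1. -/
theorem sum_operationElement (M : ProbAutomaton α Q) (σ : TapeSymbol α) :
    ∑ x, (M.operationElement 𝕜 σ x).conjTranspose * M.operationElement 𝕜 σ x = 1 := by
  simp only [operationElement, Matrix.conjTranspose_single, RCLike.star_def, RCLike.conj_ofReal,
    Matrix.single_mul_single_same, sqrt_A_mul_self]
  rw [Fintype.sum_prod_type_right, ← Matrix.diagonal_one, ← Matrix.sum_single_eq_diagonal]
  refine Finset.sum_congr rfl fun i _ => ?_
  have h := map_sum (Matrix.singleAddMonoidHom (α := 𝕜) i i) (fun j => (M.A σ j i : 𝕜)) Finset.univ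
  rw [← RCLike.ofReal_sum, M.A_sum, RCLike.ofReal_one] at h
  exact h.symm

/-- The result is diagonal and sees only a diagonal entry of `ρ`. Coherences therefore never matter,
and the diagonal evolves as a classical probability vector. -/
theorem operationElement_conj (M : ProbAutomaton α Q) (σ : TapeSymbol α) (x : Q × Q)
    (ρ : Matrix Q Q 𝕜) :
    M.operationElement 𝕜 σ x * ρ * (M.operationElement 𝕜 σ x).conjTranspose =
      Matrix.single x.1 x.1 ((M.A σ x.1 x.2 : 𝕜) * ρ x.2 x.2) := by
  simp only [operationElement, Matrix.conjTranspose_single, RCLike.star_def, RCLike.conj_ofReal,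
    Matrix.single_mul_mul_single]
  rw [mul_right_comm, sqrt_A_mul_self]

/-- The quantum automaton that simulates a probabilistic automaton. -/
noncomputable def toQuantum (M : ProbAutomaton α Q) : QuantumAutomaton 𝕜 α Q where
  init := M.init
  k _ := Fintype.card (Q × Q)
  E σ i := M.operationElement 𝕜 σ ((Fintype.equivFin (Q × Q)).symm i)
  E_complete σ := by
    rw [← M.sum_operationElement 𝕜 σ]
    exact (Fintype.equivFin (Q × Q)).symm.sum_comp fun x =>
      (M.operationElement 𝕜 σ x).conjTranspose * M.operationElement 𝕜 σ x

theorem toQuantum_step_diag (M : ProbAutomaton α Q) {ρ : Matrix Q Q 𝕜} {v : Q → ℝ}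
    (h : ∀ q, ρ q q = (v q : 𝕜)) (σ : TapeSymbol α) (q : Q) :
    (M.toQuantum 𝕜).step ρ σ q q = (((M.A σ).mulVec v q : ℝ) : 𝕜) := by
  have hstep : (M.toQuantum 𝕜).step ρ σ = ∑ x, M.operationElement 𝕜 σ x * ρ *
      (M.operationElement 𝕜 σ x).conjTranspose :=
    (Fintype.equivFin (Q × Q)).symm.sum_comp fun x =>
      M.operationElement 𝕜 σ x * ρ * (M.operationElement 𝕜 σ x).conjTranspose
  rw [hstep]
  simp [operationElement_conj, Matrix.sum_apply, Fintype.sum_prod_type, Matrix.single_apply,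
    Matrix.mulVec, dotProduct, h, Finset.sum_ite_irrel]

theorem toQuantum_foldl_diag (M : ProbAutomaton α Q) (l : List (TapeSymbol α))
    {ρ : Matrix Q Q 𝕜} {v : Q → ℝ} (h : ∀ q, ρ q q = (v q : 𝕜)) (q : Q) :
    l.foldl (M.toQuantum 𝕜).step ρ q q =
      ((l.foldl (fun v σ => (M.A σ).mulVec v) v q : ℝ) : 𝕜) := by
  induction l generalizing ρ v with
  | nil => exact h q
  | cons σ l ih => exact ih (M.toQuantum_step_diag 𝕜 h σ)

theorem toQuantum_outcomeProb {Δ : Type*} [DecidableEq Δ] (M : ProbAutomaton α Q) (f : Q → Δ)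
    (τ : Δ) (w : List α) : (M.toQuantum 𝕜).outcomeProb f τ w = M.outcomeProb f τ w := by
  rw [QuantumAutomaton.outcomeProb_eq_sum, outcomeProb]
  refine Finset.sum_congr rfl fun q _ => ?_
  have h := M.toQuantum_foldl_diag 𝕜 (tapeWord w) (ρ := Matrix.single M.init M.init 1)
    (v := Pi.single M.init 1) (fun q => by
      by_cases hq : q = M.init
      · subst hq; simp
      · simp [hq, Ne.symm hq]) q
  exact (congrArg RCLike.re h).trans (RCLike.ofReal_re _)

end ProbAutomaton

theorem PostBS_subset_PostBQAL (𝕜 : Type*) [RCLike 𝕜] (α : Type*) :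
    PostBS α ⊆ PostBQAL 𝕜 α := by
  rintro L ⟨Q, _, _, M, hM⟩
  let N : QFAP 𝕜 α Q :=
    { toQuantumAutomaton := M.toProbAutomaton.toQuantum 𝕜
      outcome := M.outcome
      postselects := fun w => by
        simpa only [ProbAutomaton.toQuantum_outcomeProb] using M.postselects w }
  have ha : N.preAcc = M.preAcc := funext fun w =>
    M.toProbAutomaton.toQuantum_outcomeProb 𝕜 M.outcome PostOutcome.pa w
  have hr : N.preRej = M.preRej := funext fun w =>
    M.toProbAutomaton.toQuantum_outcomeProb 𝕜 M.outcome PostOutcome.pr w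
  have ha' : N.acceptProb = M.acceptProb := funext fun w => by
    rw [QFAP.acceptProb, PFAP.acceptProb, ha, hr]
  have hr' : N.rejectProb = M.rejectProb := funext fun w => by
    rw [QFAP.rejectProb, PFAP.rejectProb, ha, hr]
  exact ⟨Q, _, _, N, by rwa [ha', hr']⟩

/-! ### A probabilistic automaton with postselection for the witness language -/

namespace LeqCoeq

/-- States: `none` is the initial state, `some none` a sink, and `some (some (c, i))` the `i`-th
of three branches that are entered on the first letter `c`. -/
abbrev State : Type := Option (Option (AB × Fin 3))

/-- The probability of staying in a branch when a letter is read. -/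
noncomputable def stay : AB → Fin 3 → ℝ
  | _, 0 => 1 / 8
  | AB.a, 1 => 1 / 64
  | AB.b, 1 => 1
  | AB.a, 2 => 1
  | AB.b, 2 => 1 / 64

/-- The probability of entering each branch on the first letter. -/
noncomputable def enter : Fin 3 → ℝ
  | 0 => 2 / 3
  | 1 => 1 / 6
  | 2 => 1 / 6

/-- The probability of the transition from the second argument to the third. -/
noncomputable def trans : TapeSymbol AB → State → State → ℝ
  | TapeSymbol.letter _, none, none => 0
  | TapeSymbol.letter _, none, some none => 0
  | TapeSymbol.letter c, none, some (some (d, i)) => if d = c then enter i else 0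
  | TapeSymbol.letter _, some none, j => if j = some none then 1 else 0
  | TapeSymbol.letter _, some (some _), none => 0
  | TapeSymbol.letter c, some (some x), some none => 1 - stay c x.2
  | TapeSymbol.letter c, some (some x), some (some y) => if y = x then stay c x.2 else 0
  | TapeSymbol.leftEnd, i, j => if j = i then 1 else 0
  | TapeSymbol.rightEnd, i, j => if j = i then 1 else 0

theorem stay_mem (c : AB) (i : Fin 3) : 0 < stay c i ∧ stay c i ≤ 1 := by
  cases c <;> fin_cases i <;> norm_num [stay]

theorem enter_pos (i : Fin 3) : 0 < enter i := by
  fin_cases i <;> norm_num [enter]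

theorem trans_nonneg (σ : TapeSymbol AB) (i j : State) : 0 ≤ trans σ i j := by
  rcases σ with _ | c | _
  · simp only [trans]; split_ifs <;> norm_num
  · rcases i with _ | _ | x <;> rcases j with _ | _ | y <;> simp only [trans] <;>
      (try split_ifs) <;>
      first
        | exact le_rfl
        | exact zero_le_one
        | exact (enter_pos _).le
        | exact (stay_mem _ _).1.le
        | exact sub_nonneg.2 (stay_mem _ _).2
  · simp only [trans]; split_ifs <;> norm_num

theorem trans_sum (σ : TapeSymbol AB) (i : State) : ∑ j, trans σ i j = 1 := by
  rcases σ with _ | c | _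
  · simp [trans]
  · rcases i with _ | _ | x
    · simp [trans, Fintype.sum_option, Fintype.sum_prod_type_right, Fin.sum_univ_three, enter]
      norm_num
    · simp [trans]
    · simp [trans, Fintype.sum_option]
  · simp [trans]

/-- The transition part of the automaton. -/
noncomputable def auto : ProbAutomaton AB State where
  init := none
  A σ j i := trans σ i j
  A_nonneg σ j i := trans_nonneg σ i j
  A_sum := trans_sum

theorem auto_A (σ : TapeSymbol AB) (i j : State) : auto.A σ j i = trans σ i j := rfl

theorem auto_init : auto.init = none := rfl

/-- On first letter `a`, branch `0` accepts and the others reject; on first letter `b`, the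
roles are interchanged. -/
def outcome : State → PostOutcome
  | none => PostOutcome.pr
  | some none => PostOutcome.nh
  | some (some (AB.a, 0)) => PostOutcome.pa
  | some (some (AB.a, 1)) => PostOutcome.pr
  | some (some (AB.a, 2)) => PostOutcome.pr
  | some (some (AB.b, 0)) => PostOutcome.pr
  | some (some (AB.b, 1)) => PostOutcome.pa
  | some (some (AB.b, 2)) => PostOutcome.pa

theorem mulVec_endMarker (v : State → ℝ) :
    (auto.A TapeSymbol.leftEnd).mulVec v = v ∧ (auto.A TapeSymbol.rightEnd).mulVec v = v := by
  constructor <;> ext q <;> simp [auto_A, trans, Matrix.mulVec, dotProduct]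

/-- Branches are entered only from the initial state. Once that state has weight zero, each branch
only loses weight to the sink, by one factor `stay` per letter. -/
theorem foldl_letters (w : List AB) (v : State → ℝ) (hv : v none = 0) :
    (w.map TapeSymbol.letter).foldl (fun v σ => (auto.A σ).mulVec v) v none = 0 ∧
    ∀ x : AB × Fin 3,
      (w.map TapeSymbol.letter).foldl (fun v σ => (auto.A σ).mulVec v) v (some (some x)) =
        v (some (some x)) * (w.map (stay · x.2)).prod := by
  induction w generalizing v with
  | nil => simpa using hv
  | cons c w ih =>
    have h := ih ((auto.A (TapeSymbol.letter c)).mulVec v)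
      (by simp [auto_A, trans, Matrix.mulVec, dotProduct, Fintype.sum_option])
    refine ⟨h.1, fun x => (h.2 x).trans ?_⟩
    have : (auto.A (TapeSymbol.letter c)).mulVec v (some (some x)) =
        stay c x.2 * v (some (some x)) := by
      simp [auto_A, trans, Matrix.mulVec, dotProduct, Fintype.sum_option, hv]
    rw [this, List.map_cons, List.prod_cons]
    ring

theorem finalVec_nil : auto.finalVec [] = Pi.single none 1 := by
  simp only [ProbAutomaton.finalVec, tapeWord, List.map_nil, List.nil_append, List.foldl_cons,
    List.foldl_nil, mulVec_endMarker, auto_init]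

theorem finalVec_cons (c : AB) (w : List AB) :
    auto.finalVec (c :: w) none = 0 ∧ ∀ x : AB × Fin 3,
      auto.finalVec (c :: w) (some (some x)) =
        if x.1 = c then enter x.2 * (w.map (stay · x.2)).prod else 0 := by
  have hrun : auto.finalVec (c :: w) =
      (w.map TapeSymbol.letter).foldl (fun v σ => (auto.A σ).mulVec v)
        ((auto.A (TapeSymbol.letter c)).mulVec (Pi.single none 1)) := by
    simp only [ProbAutomaton.finalVec, tapeWord, List.map_cons, List.cons_append, List.foldl_cons,
      List.foldl_append, List.foldl_nil, mulVec_endMarker, auto_init]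
  have h := foldl_letters w ((auto.A (TapeSymbol.letter c)).mulVec (Pi.single none 1))
    (by simp [auto_A, trans])
  rw [hrun]
  refine ⟨h.1, fun x => (h.2 x).trans ?_⟩
  simp [auto_A, trans]

/-- As `1/64 = (1/8)^2`, the three branches carry the monomials `x * y`, `x^2` and `y^2` in `x =
(1/8)^|w|_a`, `y = (1/8)^|w|_b`. -/
theorem prod_stay (w : List AB) :
    (w.map (stay · 0)).prod = (1 / 8) ^ w.count AB.a * (1 / 8) ^ w.count AB.b ∧
    (w.map (stay · 1)).prod = ((1 / 8) ^ w.count AB.a) ^ 2 ∧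
    (w.map (stay · 2)).prod = ((1 / 8) ^ w.count AB.b) ^ 2 := by
  induction w with
  | nil => simp
  | cons c w ih =>
    obtain ⟨h0, h1, h2⟩ := ih
    simp only [List.map_cons, List.prod_cons, h0, h1, h2]
    cases c <;> simp [stay] <;> ring_nf <;> simp

theorem sum_AB (f : AB → ℝ) : ∑ c, f c = f AB.a + f AB.b := by
  change ∑ c ∈ {AB.a, AB.b}, f c = _
  exact Finset.sum_pair (by decide)

/-- The empty input never leaves the initial state, whose type is `pr`; this secures both
postselection and rejection. -/
theorem outcomeProb_nil :
    auto.outcomeProb outcome PostOutcome.pa [] = 0 ∧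
    auto.outcomeProb outcome PostOutcome.pr [] = 1 := by
  simp only [ProbAutomaton.outcomeProb, Finset.sum_filter, Fintype.sum_option,
    Fintype.sum_prod_type, sum_AB, Fin.sum_univ_three]
  constructor <;> simp [finalVec_nil, outcome]

theorem outcomeProb_cons_a (w : List AB) :
    auto.outcomeProb outcome PostOutcome.pa (AB.a :: w) =
      2 / 3 * ((1 / 8) ^ w.count AB.a * (1 / 8) ^ w.count AB.b) ∧
    auto.outcomeProb outcome PostOutcome.pr (AB.a :: w) =
      1 / 6 * (((1 / 8) ^ w.count AB.a) ^ 2 + ((1 / 8) ^ w.count AB.b) ^ 2) := by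
  simp only [ProbAutomaton.outcomeProb, Finset.sum_filter, Fintype.sum_option,
    Fintype.sum_prod_type, sum_AB, Fin.sum_univ_three]
  constructor <;> simp [finalVec_cons, outcome, enter, prod_stay, mul_add]

theorem outcomeProb_cons_b (w : List AB) :
    auto.outcomeProb outcome PostOutcome.pr (AB.b :: w) =
      2 / 3 * ((1 / 8) ^ w.count AB.a * (1 / 8) ^ w.count AB.b) ∧
    auto.outcomeProb outcome PostOutcome.pa (AB.b :: w) =
      1 / 6 * (((1 / 8) ^ w.count AB.a) ^ 2 + ((1 / 8) ^ w.count AB.b) ^ 2) := by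
  simp only [ProbAutomaton.outcomeProb, Finset.sum_filter, Fintype.sum_option,
    Fintype.sum_prod_type, sum_AB, Fin.sum_univ_three]
  constructor <;> simp [finalVec_cons, outcome, enter, prod_stay, mul_add]

/-- For `m < n` the smaller power is at most an eighth of the larger one, so the square of the
larger already dominates. -/
theorem eight_mul_le {m n : ℕ} (h : m ≠ n) :
    8 * ((1 / 8 : ℝ) ^ m * (1 / 8) ^ n) ≤ ((1 / 8) ^ m) ^ 2 + ((1 / 8) ^ n) ^ 2 := by
  wlog hmn : m < n generalizing m n
  · have := this h.symm (lt_of_le_of_ne (not_lt.1 hmn) h.symm)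
    linarith
  have hn : (1 / 8 : ℝ) ^ n ≤ (1 / 8) ^ m * (1 / 8) := by
    rw [← pow_succ]
    exact pow_le_pow_of_le_one (by norm_num) (by norm_num) hmn
  have hm : (0 : ℝ) < (1 / 8) ^ m := by positivity
  nlinarith [mul_le_mul_of_nonneg_left hn hm.le, sq_nonneg ((1 / 8 : ℝ) ^ n)]

/-- The probabilistic automaton with postselection that recognizes the witness language. -/
noncomputable def machine : PFAP AB State where
  toProbAutomaton := auto
  outcome := outcome
  postselects w := by
    rcases w with _ | ⟨_ | _, w⟩
    · rw [outcomeProb_nil.1, outcomeProb_nil.2]; norm_num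
    · rw [(outcomeProb_cons_a w).1, (outcomeProb_cons_a w).2]; positivity
    · rw [(outcomeProb_cons_b w).1, (outcomeProb_cons_b w).2]; positivity

theorem machine_boundedErrorRecognizes :
    BoundedErrorRecognizes machine.acceptProb machine.rejectProb LeqCoeq := by
  have hpos : ∀ w, 0 < machine.preAcc w + machine.preRej w := machine.postselects
  -- A ratio of at least 2 to 1 before normalization is a probability of at least 2/3 after it,
  -- whence the error bound 1/3.
  have hacc : ∀ w, 2 * machine.preRej w ≤ machine.preAcc w → 1 - 1 / 3 ≤ machine.acceptProb w := by
    intro w h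
    rw [PFAP.acceptProb, le_div_iff₀ (hpos w)]
    linarith
  have hrej : ∀ w, 2 * machine.preAcc w ≤ machine.preRej w → 1 - 1 / 3 ≤ machine.rejectProb w := by
    intro w h
    rw [PFAP.rejectProb, le_div_iff₀ (hpos w)]
    linarith
  have preAcc_eq : machine.preAcc = auto.outcomeProb outcome PostOutcome.pa := rfl
  have preRej_eq : machine.preRej = auto.outcomeProb outcome PostOutcome.pr := rfl
  refine ⟨1 / 3, by norm_num, by norm_num, fun w hw => hacc w ?_, fun w hw => hrej w ?_⟩ <;>
    rw [preAcc_eq, preRej_eq] <;> rcases w with _ | ⟨_ | _, w⟩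
  · exact absurd hw nil_notMem_LeqCoeq
  · rw [(outcomeProb_cons_a w).1, (outcomeProb_cons_a w).2, cons_a_mem_LeqCoeq.1 hw]
    linarith
  · rw [(outcomeProb_cons_b w).1, (outcomeProb_cons_b w).2]
    linarith [eight_mul_le (cons_b_mem_LeqCoeq.1 hw)]
  · rw [outcomeProb_nil.1, outcomeProb_nil.2]; norm_num
  · rw [(outcomeProb_cons_a w).1, (outcomeProb_cons_a w).2]
    linarith [eight_mul_le (mt cons_a_mem_LeqCoeq.2 hw)]
  · rw [(outcomeProb_cons_b w).1, (outcomeProb_cons_b w).2,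
      not_not.1 (mt cons_b_mem_LeqCoeq.2 hw)]
    linarith

theorem mem_PostBS : LeqCoeq ∈ PostBS AB :=
  ⟨State, _, _, machine, machine_boundedErrorRecognizes⟩

end LeqCoeq

theorem mainTheorem10 {𝕜 : Type*} [RCLike 𝕜] :
    (∀ (α : Type*) [Finite α], PostRQAL 𝕜 α ⊆ PostBQAL 𝕜 α) ∧
      PostRQAL 𝕜 AB ⊂ PostBQAL 𝕜 AB ∧
      LeqCoeq ∈ PostBQAL 𝕜 AB ∧ LeqCoeq ∉ PostRQAL 𝕜 AB ∧
      LeqCoeq ∈ PostBS AB ∧ LeqCoeq ∉ NQAL 𝕜 AB := by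
  have hmem : LeqCoeq ∈ PostBQAL 𝕜 AB := PostBS_subset_PostBQAL 𝕜 AB LeqCoeq.mem_PostBS
  have hnot : LeqCoeq ∉ PostRQAL 𝕜 AB := fun h =>
    LeqCoeq_notMem_NQAL 𝕜 (PostRQAL_subset_NQAL 𝕜 AB h)
  exact ⟨fun α _ => PostRQAL_subset_PostBQAL 𝕜 α,
    (PostRQAL_subset_PostBQAL 𝕜 AB).ssubset_of_mem_notMem hmem hnot, hmem, hnot,
    LeqCoeq.mem_PostBS, LeqCoeq_notMem_NQAL 𝕜⟩
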